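/- Let $d\ge 1$, let $M\subset\mathbb{R}^d$ be bounded, fix $x,y\in M$ and put $d_{xy}=\|x-y\|$ (Euclidean norm). Let $C_M>0$ be such that $M$ is contained in the closed ball of radius $C_M$ centred at the origin. 1. (Half-spaces.) Let $X$ be uniformly distributed on the unit sphere $\mathbb{S}^{d-1}=\{z\in\mathbb{R}^d:\|z\|=1\}$ (with $\mathbb{S}^0=\{-1,1\}$), let $R$ be uniformly distributed on $[-C_M,C_M]$ and independent of $X$, and let $H=\{z\in M:\langle z,X\rangle\ge R\}$. Then $$P(x,y\in H)=\frac12-\frac{1}{\Omega_1}\,d_{xy},\qquad \Omega_1=\frac{4\sqrt{\pi}\,C_M\,\Gamma((d+1)/2)}{\Gamma(d/2)}.$$ 2. (Balls.) Let $a>0$, let $Y$ be uniformly distributed on the closed ball of radius $C_M+a/2$ centred at the origin, let $D$ be uniformly distributed on $[0,a]$ and independent of $Y$, and let $B=\{z\in M:\|z-Y\|\le D/2\}$. Then $$P(x,y\in B)=\frac{1}{\Omega_2}\left(a^d B_{1-d_{xy}^2/a^2}\!\left(\tfrac{d+1}{2},\tfrac12\right)-\frac{d_{xy}^{d+1}}{a}B_{1-d_{xy}^2/a^2}\!\left(\tfrac{d+1}{2},-\tfrac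 d2\right)\right)\mathbf{1}_{d_{xy}\le a},$$ where the right-hand side is $0$ if $d_{xy}>a$, the term $d_{xy}^{d+1}B_{1-d_{xy}^2/a^2}((d+1)/2,-d/2)$ is defined as $0$ for $d_{xy}=0$, $$\Omega_2=\frac{(d+1)\sqrt{\pi}\,(2C_M+a)^d\,\Gamma((d+1)/2)}{\Gamma(d/2+1)},$$ and $B_u(p,q)=\int_0^u t^{p-1}(1-t)^{q-1}\,dt$ is the incomplete Beta function ($p>0$, and either $0\le u<1$, $q\in\mathbb{R}$, or $u=1$, $q>0$). 3. (Hyperrectangles.) Let $a_1,\dots,a_d>0$, let $R_1,\dots,R_d$ be such that $M\subseteq\prod_{k=1}^d[-R_k,R_k]$, let $Z=(Z^1,\dots,Z^d)$ be uniformly distributed on $\prod_{k=1}^d[-(R_k+a_k),R_k+a_k]$, and let $E=\{z\in M:|z_k-Z^k|\le a_k,\ k=1,\dots,d\}$. Then $$P(x,y\in E)=\prod_{k=1}^d\frac{1}{2(R_k+a_k)}\,(2a_k-|x_k-y_k|)_+,\qquad t_+=\max(t,0).$$ -/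

import Mathlib

open MeasureTheory ProbabilityTheory

noncomputable section

/-- The closed half-space `H(u, r) = {z : ⟪z, u⟫ ≥ r}` with unit normal vector `u`. -/
def halfSpaceAt {d : ℕ} (u : Metric.sphere (0 : EuclideanSpace ℝ (Fin d)) 1) (r : ℝ) :
    Set (EuclideanSpace ℝ (Fin d)) :=
  {z | r ≤ inner ℝ z (u : EuclideanSpace ℝ (Fin d))}

/-- The hyperrectangle `E(c) = {z : |z_k - c_k| ≤ a_k for all k}` with centre `c` and
half side lengths `a_k`. -/
def hyperrectangleAt {d : ℕ} (a : Fin d → ℝ) (c : EuclideanSpace ℝ (Fin d)) :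
    Set (EuclideanSpace ℝ (Fin d)) :=
  {z | ∀ k, |z k - c k| ≤ a k}

/-- The incomplete Beta function `B_x(p, q) = ∫_0^x t^(p-1) (1-t)^(q-1) dt`. The integral converges
for `p > 0` and `0 ≤ x < 1` with any real `q`, and for `x = 1` if also `q > 0`. -/
def incompleteBeta (x p q : ℝ) : ℝ :=
  ∫ t in (0 : ℝ)..x, t ^ (p - 1) * (1 - t) ^ (q - 1)

/-- The constant `Ω₁ = 4 √π C Γ((d+1)/2) / Γ(d/2)`. -/
def omegaOne (d : ℕ) (C : ℝ) : ℝ :=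
  4 * √Real.pi * C * Real.Gamma (((d : ℝ) + 1) / 2) / Real.Gamma ((d : ℝ) / 2)

/-- The constant `Ω₂ = (d+1) √π (2C+a)^d Γ((d+1)/2) / Γ(d/2+1)`. -/
def omegaTwo (d : ℕ) (C a : ℝ) : ℝ :=
  ((d : ℝ) + 1) * √Real.pi * (2 * C + a) ^ d * Real.Gamma (((d : ℝ) + 1) / 2)
    / Real.Gamma ((d : ℝ) / 2 + 1)

end

/-! In each model, `x` and `y` both belong to the random set exactly when the random parameters fall
into an explicit region, whose measure is computed by Fubini.

Half-spaces: given `X = u`, the threshold must lie below `min ⟪x,u⟫ ⟪y,u⟫`, which has probability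
`1/2 + (⟪x+y,u⟫ - |⟪x-y,u⟫|)/(4C)`. The linear term averages to zero over the sphere. The mean of
`|⟪v,u⟫|` follows by computing Gaussian integrals both in Cartesian and in polar coordinates
(`average_abs_inner_toSphere`).

Balls: given `D = t`, the centre must lie in the lens of points within `t/2` of both `x` and `y`.
Slicing perpendicular to `x - y` expresses the lens volume by an incomplete Beta function
(`measureReal_inter_closedBall`). The integral over `t` has an explicit primitive made of two such
functions (`integral_pow_mul_incompleteBeta`).

Hyperrectangles: the centre must lie in an intersection of two boxes, again a box, so the
probability is a ratio of products of side lengths. -/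

/-! ### Conditioning on one of two independent variables. -/

theorem ProbabilityTheory.IndepFun.measureReal_eq_integral {Ω α β : Type*} [MeasurableSpace Ω]
    [MeasurableSpace α] [MeasurableSpace β] {P : Measure Ω} [IsProbabilityMeasure P]
    {X : Ω → α} {Y : Ω → β} (hX : Measurable X) (hY : Measurable Y) (h : IndepFun X Y P)
    {A : Set (α × β)} (hA : MeasurableSet A) :
    P.real {ω | (X ω, Y ω) ∈ A} = ∫ a, (P.map Y).real {b | (a, b) ∈ A} ∂(P.map X) := by
  have : IsProbabilityMeasure (P.map X) := Measure.isProbabilityMeasure_map hX.aemeasurable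
  have : IsProbabilityMeasure (P.map Y) := Measure.isProbabilityMeasure_map hY.aemeasurable
  have e := h.map_prod_eq_prod_map_map hX.aemeasurable hY.aemeasurable
  have h1 : P {ω | (X ω, Y ω) ∈ A} = ((P.map X).prod (P.map Y)) A := by
    rw [← e, Measure.map_apply (hX.prodMk hY) hA]; rfl
  rw [measureReal_def, h1, Measure.prod_apply hA, ← integral_toReal]
  · rfl
  · exact (measurable_measure_prodMk_left hA).aemeasurable
  · exact Filter.Eventually.of_forall fun a => measure_lt_top _ _

theorem integral_cond {α : Type*} [MeasurableSpace α] (μ : Measure α) (s : Set α) (f : α → ℝ) :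
    ∫ x, f x ∂(μ[|s]) = (μ.real s)⁻¹ * ∫ x in s, f x ∂μ := by
  rw [ProbabilityTheory.cond, integral_smul_measure, ENNReal.toReal_inv, smul_eq_mul,
    measureReal_def]

/-! ### Hyperrectangles. -/

theorem EuclideanSpace.volume_box {ι : Type*} [Fintype ι] (l u : ι → ℝ) :
    volume {z : EuclideanSpace ℝ ι | ∀ k, z k ∈ Set.Icc (l k) (u k)}
      = ∏ k, ENNReal.ofReal (u k - l k) := by
  have h := (PiLp.volume_preserving_ofLp ι).measure_preimage
    (s := Set.Icc l u) measurableSet_Icc.nullMeasurableSet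
  rw [Real.volume_Icc_pi] at h
  rw [← h]
  congr 1
  ext z
  simp only [Set.mem_ofPred_eq, Set.mem_preimage, Set.mem_Icc, Pi.le_def, forall_and]

theorem measureReal_hyperrectangle {d : ℕ} {Ω : Type*} [MeasurableSpace Ω] {P : Measure Ω}
    {a r : Fin d → ℝ} (ha : ∀ k, 0 < a k) {x y : EuclideanSpace ℝ (Fin d)}
    (hx : ∀ k, x k ∈ Set.Icc (-(r k)) (r k))
    {Z : Ω → EuclideanSpace ℝ (Fin d)}
    (hU : pdf.IsUniform Z {z | ∀ k, z k ∈ Set.Icc (-(r k + a k)) (r k + a k)} P volume) :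
    P.real {ω | x ∈ hyperrectangleAt a (Z ω) ∧ y ∈ hyperrectangleAt a (Z ω)}
      = ∏ k, 1 / (2 * (r k + a k)) * max (2 * a k - |x k - y k|) 0 := by
  set l : Fin d → ℝ := fun k => max (x k) (y k) - a k with hl
  set u : Fin d → ℝ := fun k => min (x k) (y k) + a k with hu
  have hr : ∀ k, 0 < r k + a k := fun k => by
    have h1 := hx k
    rw [Set.mem_Icc] at h1
    linarith [ha k]
  have hmeas : ∀ l u : Fin d → ℝ,
      MeasurableSet {z : EuclideanSpace ℝ (Fin d) | ∀ k, z k ∈ Set.Icc (l k) (u k)} := by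
    intro l u
    rw [Set.ofPred_forall]
    exact MeasurableSet.iInter fun k => measurableSet_Icc.preimage (by fun_prop)
  have hev : {ω | x ∈ hyperrectangleAt a (Z ω) ∧ y ∈ hyperrectangleAt a (Z ω)}
      = Z ⁻¹' {z | ∀ k, z k ∈ Set.Icc (l k) (u k)} := by
    ext ω
    simp only [hyperrectangleAt, Set.mem_ofPred_eq, Set.mem_preimage, Set.mem_Icc, ← forall_and,
      hl, hu]
    refine forall_congr' fun k => ?_
    rw [abs_le, abs_le, sub_le_iff_le_add (a := max (x k) (y k)), max_le_iff,
      ← sub_le_iff_le_add (b := min (x k) (y k)), le_min_iff]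
    constructor
    · rintro ⟨⟨h1, h2⟩, h3, h4⟩
      exact ⟨⟨by linarith, by linarith⟩, by linarith, by linarith⟩
    · rintro ⟨⟨h1, h2⟩, h3, h4⟩
      exact ⟨⟨by linarith, by linarith⟩, by linarith, by linarith⟩
  -- Since `|x k| ≤ r k`, the support of `Z` does not cut the box of admissible centres.
  have hsub : {z : EuclideanSpace ℝ (Fin d) | ∀ k, z k ∈ Set.Icc (l k) (u k)} ⊆
      {z | ∀ k, z k ∈ Set.Icc (-(r k + a k)) (r k + a k)} := by
    intro z hz k
    have h1 := hz k
    have h2 := hx k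
    simp only [Set.mem_Icc, hl, hu] at h1 h2 ⊢
    have h3 := le_max_left (x k) (y k)
    have h4 := min_le_left (x k) (y k)
    constructor <;> linarith
  have hbox := EuclideanSpace.volume_box (fun k => -(r k + a k)) (fun k => r k + a k)
  rw [measureReal_def, hev, hU.measure_preimage _ _ (hmeas l u),
    Set.inter_eq_self_of_subset_right hsub, EuclideanSpace.volume_box, hbox, ENNReal.toReal_div,
    ENNReal.toReal_prod, ENNReal.toReal_prod, ← Finset.prod_div_distrib]
  · refine Finset.prod_congr rfl fun k _ => ?_
    have hlu : u k - l k = 2 * a k - |x k - y k| := by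
      rw [← max_sub_min_eq_abs']
      simp only [hl, hu]
      ring
    -- An empty side has `u k < l k`; the truncation in `ENNReal.ofReal` then gives the positive
    -- part.
    rw [hlu, ENNReal.toReal_ofReal', ENNReal.toReal_ofReal (by linarith [hr k]), div_eq_inv_mul,
      one_div]
    congr 2
    ring
  · rw [hbox]
    refine Finset.prod_ne_zero_iff.2 fun k _ => ?_
    have := hr k
    simp only [ne_eq, ENNReal.ofReal_eq_zero, not_le]
    linarith
  · rw [hbox]
    exact ENNReal.prod_ne_top fun k _ => ENNReal.ofReal_ne_top

/-! ### Spherical averages from Gaussian integrals. -/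

/-- Polar coordinates for a product of an angular and a radial factor. No integrability is required,
because `integral_prod_mul` holds for arbitrary factors. -/
theorem integral_eq_integral_toSphere_mul {E : Type*} [NormedAddCommGroup E] [NormedSpace ℝ E]
    [MeasurableSpace E] [BorelSpace E] [FiniteDimensional ℝ E] [Nontrivial E] (μ : Measure E)
    [μ.IsAddHaarMeasure] (F : E → ℝ) (f : Metric.sphere (0 : E) 1 → ℝ) (g : ℝ → ℝ)
    (hF : ∀ (u : Metric.sphere (0 : E) 1) (t : ℝ), 0 < t → F (t • (u : E)) = f u * g t) :
    ∫ x, F x ∂μ = (∫ u, f u ∂μ.toSphere) *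
      ∫ t in Set.Ioi (0 : ℝ), t ^ (Module.finrank ℝ E - 1) * g t := by
  calc
    ∫ x, F x ∂μ = ∫ x : ({(0)}ᶜ : Set E), F x.1 ∂(μ.comap (↑)) := by
      rw [integral_subtype_comap (measurableSet_singleton _).compl fun x ↦ F x,
        restrict_compl_singleton]
    _ = ∫ x : Metric.sphere (0 : E) 1 × Set.Ioi (0 : ℝ), f x.1 * g x.2
          ∂μ.toSphere.prod (.volumeIoiPow (Module.finrank ℝ E - 1)) := by
      rw [← μ.measurePreserving_homeomorphUnitSphereProd.integral_comp
        (Homeomorph.measurableEmbedding _)]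
      refine integral_congr_ae (Filter.Eventually.of_forall fun x => ?_)
      have h0 : ‖(x : E)‖ ≠ 0 := norm_ne_zero_iff.2 x.2
      dsimp only
      rw [← hF _ _ (homeomorphUnitSphereProd E x).2.2]
      simp [smul_smul, h0]
    _ = (∫ u, f u ∂μ.toSphere) *
          ∫ x : Set.Ioi (0 : ℝ), g x ∂.volumeIoiPow (Module.finrank ℝ E - 1) :=
      integral_prod_mul f (fun t : Set.Ioi (0 : ℝ) => g t)
    _ = _ := by
      congr 1
      simp only [Measure.volumeIoiPow, ENNReal.ofReal]
      rw [integral_withDensity_eq_integral_smul,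
        integral_subtype_comap measurableSet_Ioi
          fun a ↦ Real.toNNReal (a ^ (Module.finrank ℝ E - 1)) • g a,
        setIntegral_congr_fun measurableSet_Ioi fun x hx ↦ ?_]
      · rw [NNReal.smul_def, Real.coe_toNNReal _ (pow_nonneg hx.out.le _), smul_eq_mul]
      · exact (measurable_subtype_coe.pow_const _).real_toNNReal

theorem integral_Ioi_pow_mul_exp_neg_sq (n : ℕ) :
    ∫ t in Set.Ioi (0 : ℝ), t ^ n * Real.exp (-t ^ 2) = Real.Gamma (((n : ℝ) + 1) / 2) / 2 := by
  have h := integral_rpow_mul_exp_neg_rpow (p := 2) (q := n) two_pos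
    (by linarith [Nat.cast_nonneg (α := ℝ) n])
  simp only [Real.rpow_natCast, Real.rpow_two] at h
  rw [h]
  ring

theorem EuclideanSpace.integral_exp_neg_norm_sq (n : ℕ) :
    ∫ x : EuclideanSpace ℝ (Fin n), Real.exp (-‖x‖ ^ 2) = √Real.pi ^ n := by
  have h := (PiLp.volume_preserving_ofLp (Fin n)).integral_comp
    (MeasurableEquiv.toLp 2 (Fin n → ℝ)).symm.measurableEmbedding
    (fun z : Fin n → ℝ => ∏ i, Real.exp (-(z i) ^ 2))
  rw [integral_fintype_prod_volume_eq_pow fun t : ℝ => Real.exp (-t ^ 2)] at h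
  have hg := integral_gaussian 1
  simp only [neg_mul, one_mul, div_one] at hg
  rw [hg, Fintype.card_fin] at h
  rw [← h]
  refine integral_congr_ae (Filter.Eventually.of_forall fun x => ?_)
  simp only [EuclideanSpace.norm_sq_eq, ← Real.exp_sum, Finset.sum_neg_distrib, Real.norm_eq_abs,
    sq_abs]

theorem integral_abs_mul_exp_neg_sq : ∫ t : ℝ, |t| * Real.exp (-t ^ 2) = 1 := by
  have h := integral_comp_abs (f := fun t => t * Real.exp (-t ^ 2))
  simp only [sq_abs] at h
  have h1 := integral_Ioi_pow_mul_exp_neg_sq 1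
  simp only [pow_one, Nat.cast_one] at h1
  rw [h, h1]
  norm_num

/-- The integrand factorises over the coordinates: the distinguished one contributes `1`, each of
the others `√π`. -/
theorem EuclideanSpace.integral_abs_coord_mul_exp_neg_norm_sq (n : ℕ) :
    ∫ x : EuclideanSpace ℝ (Fin (n + 1)), |x 0| * Real.exp (-‖x‖ ^ 2) = √Real.pi ^ n := by
  have h := (PiLp.volume_preserving_ofLp (Fin (n + 1))).integral_comp
    (MeasurableEquiv.toLp 2 (Fin (n + 1) → ℝ)).symm.measurableEmbedding
    (fun z : Fin (n + 1) → ℝ => ∏ i, (if i = 0 then |z i| else 1) * Real.exp (-(z i) ^ 2))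
  rw [integral_fintype_prod_volume_eq_prod
    fun (i : Fin (n + 1)) (t : ℝ) => (if i = 0 then |t| else 1) * Real.exp (-t ^ 2),
    Fin.prod_univ_succ] at h
  have hg := integral_gaussian 1
  simp only [neg_mul, one_mul, div_one] at hg
  simp only [if_true, integral_abs_mul_exp_neg_sq, Fin.succ_ne_zero, if_false, one_mul, hg,
    Finset.prod_const, Finset.card_univ, Fintype.card_fin] at h
  rw [← h]
  refine integral_congr_ae (Filter.Eventually.of_forall fun x => ?_)
  simp only [EuclideanSpace.norm_sq_eq, Finset.prod_mul_distrib, ← Real.exp_sum,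
    Finset.sum_neg_distrib, Real.norm_eq_abs, sq_abs, Finset.prod_ite_eq', Finset.mem_univ, if_true]

/-- The reflection exchanging two vectors of equal norm. -/
theorem exists_linearIsometryEquiv_apply_eq {n : ℕ} (v : EuclideanSpace ℝ (Fin (n + 1))) :
    ∃ T : EuclideanSpace ℝ (Fin (n + 1)) ≃ₗᵢ[ℝ] EuclideanSpace ℝ (Fin (n + 1)),
      T v = EuclideanSpace.single 0 ‖v‖ :=
  ⟨_, Submodule.reflection_sub (by simp)⟩

theorem EuclideanSpace.integral_abs_inner_mul_exp_neg_norm_sq {n : ℕ}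
    (v : EuclideanSpace ℝ (Fin (n + 1))) :
    ∫ x : EuclideanSpace ℝ (Fin (n + 1)), |inner ℝ v x| * Real.exp (-‖x‖ ^ 2)
      = ‖v‖ * √Real.pi ^ n := by
  obtain ⟨T, hT⟩ := exists_linearIsometryEquiv_apply_eq v
  rw [← EuclideanSpace.integral_abs_coord_mul_exp_neg_norm_sq, ← integral_const_mul,
    ← T.measurePreserving.integral_comp T.toHomeomorph.measurableEmbedding
      (fun x => ‖v‖ * (|x 0| * Real.exp (-‖x‖ ^ 2)))]
  refine integral_congr_ae (Filter.Eventually.of_forall fun x => ?_)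
  have h : inner ℝ v x = ‖v‖ * (T x) 0 := by
    rw [← T.inner_map_map, hT, EuclideanSpace.inner_single_left]
    simp
  dsimp only
  rw [h, abs_mul, abs_norm, T.norm_map, mul_assoc]

/-- The Gaussian-weighted linear form is odd, so its integral vanishes, while its radial factor is
positive. -/
theorem integral_inner_toSphere {n : ℕ} (w : EuclideanSpace ℝ (Fin (n + 1))) :
    ∫ u, inner ℝ w (u : EuclideanSpace ℝ (Fin (n + 1)))
      ∂(volume : Measure (EuclideanSpace ℝ (Fin (n + 1)))).toSphere = 0 := by
  have h := integral_eq_integral_toSphere_mul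
    (volume : Measure (EuclideanSpace ℝ (Fin (n + 1))))
    (fun x => inner ℝ w x * Real.exp (-‖x‖ ^ 2))
    (fun u => inner ℝ w (u : EuclideanSpace ℝ (Fin (n + 1))))
    (fun t => t * Real.exp (-t ^ 2))
    (fun u t ht => by
      simp only [inner_smul_right, norm_smul, norm_eq_of_mem_sphere, mul_one, Real.norm_eq_abs,
        sq_abs]
      ring)
  have h0 : ∫ x : EuclideanSpace ℝ (Fin (n + 1)), inner ℝ w x * Real.exp (-‖x‖ ^ 2) = 0 := by
    have := integral_neg_eq_self
      (fun x : EuclideanSpace ℝ (Fin (n + 1)) => inner ℝ w x * Real.exp (-‖x‖ ^ 2)) volume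
    simp only [inner_neg_right, norm_neg, neg_mul, integral_neg] at this
    linarith
  simp only [finrank_euclideanSpace_fin, Nat.add_sub_cancel, ← mul_assoc, ← pow_succ] at h
  rw [h0, integral_Ioi_pow_mul_exp_neg_sq] at h
  refine (mul_eq_zero.1 h.symm).resolve_right ?_
  have : 0 < Real.Gamma ((((n + 1 : ℕ) : ℝ) + 1) / 2) := Real.Gamma_pos_of_pos (by positivity)
  positivity

theorem integral_abs_inner_toSphere {n : ℕ} (v : EuclideanSpace ℝ (Fin (n + 1))) :
    (∫ u, |inner ℝ v (u : EuclideanSpace ℝ (Fin (n + 1)))|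
      ∂(volume : Measure (EuclideanSpace ℝ (Fin (n + 1)))).toSphere) *
      (Real.Gamma (((n + 1 : ℕ) + 1 : ℝ) / 2) / 2) = ‖v‖ * √Real.pi ^ n := by
  have h := integral_eq_integral_toSphere_mul
    (volume : Measure (EuclideanSpace ℝ (Fin (n + 1))))
    (fun x => |inner ℝ v x| * Real.exp (-‖x‖ ^ 2))
    (fun u => |inner ℝ v (u : EuclideanSpace ℝ (Fin (n + 1)))|)
    (fun t => t * Real.exp (-t ^ 2))
    (fun u t ht => by
      simp only [inner_smul_right, norm_smul, norm_eq_of_mem_sphere, mul_one, Real.norm_eq_abs,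
        abs_mul, abs_of_pos ht]
      ring)
  simp only [finrank_euclideanSpace_fin, Nat.add_sub_cancel, ← mul_assoc, ← pow_succ] at h
  rw [EuclideanSpace.integral_abs_inner_mul_exp_neg_norm_sq, integral_Ioi_pow_mul_exp_neg_sq] at h
  exact h.symm

theorem toSphere_real_univ_mul_Gamma (n : ℕ) :
    (volume : Measure (EuclideanSpace ℝ (Fin (n + 1)))).toSphere.real Set.univ *
      (Real.Gamma (((n + 1 : ℕ) : ℝ) / 2) / 2) = √Real.pi ^ (n + 1) := by
  have h := integral_eq_integral_toSphere_mul
    (volume : Measure (EuclideanSpace ℝ (Fin (n + 1))))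
    (fun x => Real.exp (-‖x‖ ^ 2)) (fun u => 1) (fun t => Real.exp (-t ^ 2))
    (fun u t ht => by simp [norm_smul])
  simp only [finrank_euclideanSpace_fin, Nat.add_sub_cancel, integral_const, smul_eq_mul,
    mul_one] at h
  rw [EuclideanSpace.integral_exp_neg_norm_sq, integral_Ioi_pow_mul_exp_neg_sq] at h
  rw [h]
  push_cast
  rfl

/-- The quotient of the two preceding identities; the Gamma values are their radial integrals, which
differ by one power of `t`. -/
theorem average_abs_inner_toSphere {n : ℕ} (v : EuclideanSpace ℝ (Fin (n + 1))) :
    ((volume : Measure (EuclideanSpace ℝ (Fin (n + 1)))).toSphere.real Set.univ)⁻¹ *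
      ∫ u, |inner ℝ v (u : EuclideanSpace ℝ (Fin (n + 1)))|
        ∂(volume : Measure (EuclideanSpace ℝ (Fin (n + 1)))).toSphere
      = ‖v‖ * Real.Gamma (((n + 1 : ℕ) : ℝ) / 2) /
        (√Real.pi * Real.Gamma (((n + 1 : ℕ) + 1 : ℝ) / 2)) := by
  have h1 := integral_abs_inner_toSphere v
  have h2 := toSphere_real_univ_mul_Gamma n
  have g1 : 0 < Real.Gamma (((n + 1 : ℕ) : ℝ) / 2) := Real.Gamma_pos_of_pos (by positivity)
  have g2 : 0 < Real.Gamma (((n + 1 : ℕ) + 1 : ℝ) / 2) := Real.Gamma_pos_of_pos (by positivity)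
  have hp : 0 < √Real.pi := Real.sqrt_pos.2 Real.pi_pos
  rw [← eq_div_iff (by positivity)] at h1 h2
  rw [h1, h2]
  field_simp
  ring

/-! ### Random half-spaces. -/

theorem measureReal_halfSpace {n : ℕ} {Ω : Type*} [MeasurableSpace Ω] {P : Measure Ω}
    [IsProbabilityMeasure P] {x y : EuclideanSpace ℝ (Fin (n + 1))} {C : ℝ} (hC : 0 < C)
    (hx : ‖x‖ ≤ C) (hy : ‖y‖ ≤ C)
    {X : Ω → Metric.sphere (0 : EuclideanSpace ℝ (Fin (n + 1))) 1} {R : Ω → ℝ}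
    (hX : Measurable X) (hR : Measurable R)
    (hXu : pdf.IsUniform X Set.univ P
      (volume : Measure (EuclideanSpace ℝ (Fin (n + 1)))).toSphere)
    (hRu : pdf.IsUniform R (Set.Icc (-C) C) P volume) (hXR : IndepFun X R P) :
    P.real {ω | x ∈ halfSpaceAt (X ω) (R ω) ∧ y ∈ halfSpaceAt (X ω) (R ω)}
      = 1 / 2 - 1 / omegaOne (n + 1) C * dist x y := by
  set σ := (volume : Measure (EuclideanSpace ℝ (Fin (n + 1)))).toSphere with hσ
  let A : Set (Metric.sphere (0 : EuclideanSpace ℝ (Fin (n + 1))) 1 × ℝ) :=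
    {p | p.2 ≤ inner ℝ x (p.1 : EuclideanSpace ℝ (Fin (n + 1))) ∧
      p.2 ≤ inner ℝ y (p.1 : EuclideanSpace ℝ (Fin (n + 1)))}
  have hA : MeasurableSet A :=
    ((isClosed_le continuous_snd (by fun_prop)).inter
      (isClosed_le continuous_snd (by fun_prop))).measurableSet
  have hslice : ∀ u : Metric.sphere (0 : EuclideanSpace ℝ (Fin (n + 1))) 1,
      (P.map R).real {r | (u, r) ∈ A} = 1 / 2 +
        (inner ℝ (x + y) (u : EuclideanSpace ℝ (Fin (n + 1))) -
        |inner ℝ (x - y) (u : EuclideanSpace ℝ (Fin (n + 1)))|) / (4 * C) := by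
    intro u
    have hu : ‖(u : EuclideanSpace ℝ (Fin (n + 1)))‖ = 1 := norm_eq_of_mem_sphere u
    have bx := abs_le.1 (abs_real_inner_le_norm x (u : EuclideanSpace ℝ (Fin (n + 1))))
    have bY := abs_le.1 (abs_real_inner_le_norm y (u : EuclideanSpace ℝ (Fin (n + 1))))
    rw [hu, mul_one] at bx bY
    set p := inner ℝ x (u : EuclideanSpace ℝ (Fin (n + 1))) with hp
    set q := inner ℝ y (u : EuclideanSpace ℝ (Fin (n + 1))) with hq
    -- By Cauchy–Schwarz `p` and `q` lie in `[-C, C]`, so the upper endpoint `C` imposes nothing.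
    have hset : Set.Icc (-C) C ∩ {r | (u, r) ∈ A} = Set.Icc (-C) (min p q) := by
      ext r
      simp only [A, Set.mem_inter_iff, Set.mem_Icc, Set.mem_ofPred_eq, le_min_iff]
      constructor
      · rintro ⟨⟨h1, h2⟩, h3, h4⟩
        exact ⟨h1, h3, h4⟩
      · rintro ⟨h1, h3, h4⟩
        exact ⟨⟨h1, by linarith [h3.trans bx.2]⟩, h3, h4⟩
    have hm : min p q = (p + q - |p - q|) / 2 := by
      rcases le_total p q with h | h
      · rw [min_eq_left h, abs_of_nonpos (by linarith)]; ring
      · rw [min_eq_right h, abs_of_nonneg (by linarith)]; ring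
    have hmC : -C ≤ min p q := le_min (by linarith) (by linarith)
    rw [measureReal_def, hRu, cond_apply measurableSet_Icc, hset, Real.volume_Icc,
      Real.volume_Icc, ENNReal.toReal_mul, ENNReal.toReal_inv,
      ENNReal.toReal_ofReal (by linarith), ENNReal.toReal_ofReal (by linarith), hm,
      inner_add_left, inner_sub_left]
    field_simp
    ring
  have hint1 : Integrable (fun u : Metric.sphere (0 : EuclideanSpace ℝ (Fin (n + 1))) 1 =>
      inner ℝ (x + y) (u : EuclideanSpace ℝ (Fin (n + 1)))) σ :=
    Continuous.integrable_of_hasCompactSupport (by fun_prop) (HasCompactSupport.of_compactSpace _)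
  have hint2 : Integrable (fun u : Metric.sphere (0 : EuclideanSpace ℝ (Fin (n + 1))) 1 =>
      |inner ℝ (x - y) (u : EuclideanSpace ℝ (Fin (n + 1)))|) σ :=
    Continuous.integrable_of_hasCompactSupport (by fun_prop) (HasCompactSupport.of_compactSpace _)
  have hint3 : Integrable (fun u : Metric.sphere (0 : EuclideanSpace ℝ (Fin (n + 1))) 1 =>
      (inner ℝ (x + y) (u : EuclideanSpace ℝ (Fin (n + 1))) -
        |inner ℝ (x - y) (u : EuclideanSpace ℝ (Fin (n + 1)))|) / (4 * C)) σ :=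
    (hint1.sub hint2).div_const _
  have hev : {ω | x ∈ halfSpaceAt (X ω) (R ω) ∧ y ∈ halfSpaceAt (X ω) (R ω)}
      = {ω | (X ω, R ω) ∈ A} := rfl
  have hσ0 : σ.real Set.univ ≠ 0 := by
    intro h
    have := toSphere_real_univ_mul_Gamma n
    rw [← hσ, h, zero_mul] at this
    exact (pow_ne_zero _ (Real.sqrt_ne_zero'.2 Real.pi_pos)) this.symm
  have hav := average_abs_inner_toSphere (x - y)
  have g1 : 0 < Real.Gamma (((n + 1 : ℕ) : ℝ) / 2) := Real.Gamma_pos_of_pos (by positivity)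
  have g2 : 0 < Real.Gamma (((n + 1 : ℕ) + 1 : ℝ) / 2) := Real.Gamma_pos_of_pos (by positivity)
  have hp : 0 < √Real.pi := Real.sqrt_pos.2 Real.pi_pos
  rw [hev, hXR.measureReal_eq_integral hX hR hA]
  simp only [hslice]
  rw [hXu, integral_cond, Measure.restrict_univ, integral_add (integrable_const _)
    hint3, integral_const, integral_div, integral_sub hint1 hint2,
    integral_inner_toSphere, zero_sub, smul_eq_mul, mul_add, inv_mul_cancel_left₀ hσ0, neg_div,
    mul_neg, mul_div, hav, omegaOne, dist_eq_norm]
  field_simp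
  ring

/-! ### Calculus of the incomplete Beta function. -/

theorem continuousOn_incompleteBeta_integrand {p : ℝ} (hp : 1 ≤ p) (q : ℝ) :
    ContinuousOn (fun t : ℝ => t ^ (p - 1) * (1 - t) ^ (q - 1)) (Set.Iio 1) := by
  refine ContinuousOn.mul (Real.continuous_rpow_const (by linarith)).continuousOn ?_
  refine ContinuousOn.rpow_const (by fun_prop) fun t ht => Or.inl ?_
  have : t < 1 := ht
  linarith

theorem hasDerivAt_incompleteBeta {p : ℝ} (hp : 1 ≤ p) (q : ℝ) {u : ℝ} (hu : u < 1) :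
    HasDerivAt (fun v => incompleteBeta v p q) (u ^ (p - 1) * (1 - u) ^ (q - 1)) u := by
  have hc := continuousOn_incompleteBeta_integrand hp q
  refine intervalIntegral.integral_hasDerivAt_right ?_
    (hc.stronglyMeasurableAtFilter isOpen_Iio u hu) (hc.continuousAt (Iio_mem_nhds hu))
  refine (hc.mono fun t ht => ?_).intervalIntegrable
  exact lt_of_le_of_lt ht.2 (max_lt one_pos hu)

/-- Covers the endpoint `1`, where the integrand may be singular and only integrability, from `0 <
q`, is available. -/
theorem continuousOn_incompleteBeta {p q : ℝ} (hp : 1 ≤ p) (hq : 0 < q) :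
    ContinuousOn (fun v => incompleteBeta v p q) (Set.Icc 0 1) := by
  have h1 : IntervalIntegrable (fun t : ℝ => (1 - t) ^ (q - 1)) volume 0 1 := by
    have h := (intervalIntegral.intervalIntegrable_rpow' (a := 0) (b := 1)
      (show -1 < q - 1 by linarith)).comp_sub_left 1
    simpa using h.symm
  have h2 : IntervalIntegrable (fun t : ℝ => t ^ (p - 1) * (1 - t) ^ (q - 1)) volume 0 1 :=
    h1.continuousOn_mul (Real.continuous_rpow_const (by linarith)).continuousOn
  have := intervalIntegral.continuousOn_primitive_interval' h2 Set.left_mem_uIcc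
  rwa [Set.uIcc_of_le zero_le_one] at this

theorem incompleteBeta_zero (p q : ℝ) : incompleteBeta 0 p q = 0 := by
  simp [incompleteBeta]

/-- Below, `1 - t` is a square and its exponents are negative half-integers, so the real powers
become natural powers. -/
theorem sq_rpow_neg_half {w : ℝ} (hw : 0 < w) (k : ℕ) :
    (w ^ 2) ^ (-(k : ℝ) / 2) = w⁻¹ ^ k := by
  rw [← Real.rpow_natCast w, ← Real.rpow_mul hw.le, ← Real.rpow_natCast, Real.inv_rpow hw.le,
    ← Real.rpow_neg hw.le]
  congr 1
  push_cast
  ring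

theorem rpow_succ_succ_half_sub_one {u : ℝ} (hu : 0 ≤ u) (n : ℕ) :
    u ^ ((((n + 1 : ℕ) : ℝ) + 1) / 2 - 1) = √u ^ n := by
  rw [Real.sqrt_eq_rpow, ← Real.rpow_natCast, ← Real.rpow_mul hu]
  congr 1
  push_cast
  ring

theorem one_le_succ_succ_half (n : ℕ) : 1 ≤ (((n + 1 : ℕ) : ℝ) + 1) / 2 := by
  have : (0 : ℝ) ≤ n := n.cast_nonneg
  push_cast
  linarith

/-- The substitution `t = 1 - s²/r²`, checked by differentiating. At `s = 0` the Beta argument is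
`1`, so differentiability is used only in the open interval and continuity at its ends. -/
theorem integral_sqrt_sq_sub_sq_pow (n : ℕ) {h r : ℝ} (h0 : 0 ≤ h) (hr : h ≤ r) (r0 : 0 < r) :
    ∫ s in h..r, √(r ^ 2 - s ^ 2) ^ n
      = r ^ (n + 1) / 2 *
        incompleteBeta (1 - h ^ 2 / r ^ 2) ((((n + 1 : ℕ) : ℝ) + 1) / 2) (1 / 2) := by
  have hp := one_le_succ_succ_half n
  have key := intervalIntegral.integral_eq_sub_of_hasDerivAt_of_le hr
    (f := fun s => -(r ^ (n + 1) / 2 *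
      incompleteBeta (1 - s ^ 2 / r ^ 2) ((((n + 1 : ℕ) : ℝ) + 1) / 2) (1 / 2)))
    (f' := fun s => √(r ^ 2 - s ^ 2) ^ n) ?_ ?_ ?_
  · rw [key]
    simp [incompleteBeta_zero, r0.ne']
  · refine (ContinuousOn.mul continuousOn_const ?_).neg
    refine (continuousOn_incompleteBeta hp (by norm_num)).comp (by fun_prop) ?_
    intro s hs
    have hs0 : 0 ≤ s := h0.trans hs.1
    have h1 : s ^ 2 / r ^ 2 ≤ 1 := by
      rw [div_le_one (by positivity)]
      exact pow_le_pow_left₀ hs0 hs.2 2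
    have h2 : 0 ≤ s ^ 2 / r ^ 2 := by positivity
    exact ⟨by linarith, by linarith⟩
  · intro s hs
    have hs0 : 0 < s := h0.trans_lt hs.1
    have hsr : s < r := hs.2
    have hlt : s ^ 2 < r ^ 2 := pow_lt_pow_left₀ hsr hs0.le two_ne_zero
    have hu1 : 1 - s ^ 2 / r ^ 2 < 1 := by
      have : 0 < s ^ 2 / r ^ 2 := by positivity
      linarith
    have hu0 : 1 - s ^ 2 / r ^ 2 = (r ^ 2 - s ^ 2) / r ^ 2 := by field_simp
    have hd : HasDerivAt (fun s : ℝ => 1 - s ^ 2 / r ^ 2) (-(2 * s / r ^ 2)) s := by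
      have := ((hasDerivAt_pow 2 s).div_const (r ^ 2)).const_sub 1
      simpa using this
    have hB := ((hasDerivAt_incompleteBeta hp (1 / 2) hu1).comp s hd).const_mul (r ^ (n + 1) / 2)
    refine hB.neg.congr_deriv ?_
    have e1 : (1 - (1 - s ^ 2 / r ^ 2)) ^ ((1 : ℝ) / 2 - 1) = r / s := by
      have := sq_rpow_neg_half (show 0 < s / r by positivity) 1
      rw [show (1 - (1 - s ^ 2 / r ^ 2)) = (s / r) ^ 2 by rw [div_pow]; ring,
        show ((1 : ℝ) / 2 - 1) = -((1 : ℕ) : ℝ) / 2 by norm_num, this, pow_one, inv_div]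
    have e2 : √(1 - s ^ 2 / r ^ 2) = √(r ^ 2 - s ^ 2) / r := by
      rw [hu0, Real.sqrt_div' _ (by positivity), Real.sqrt_sq r0.le]
    rw [e1, rpow_succ_succ_half_sub_one (by rw [hu0]; exact div_nonneg (by linarith) (by positivity)),
      e2, div_pow]
    field_simp
    ring
  · exact (Continuous.pow (by fun_prop) n).intervalIntegrable _ _

theorem continuousOn_incompleteBeta_one_sub_sq_div_sq {p : ℝ} (hp : 1 ≤ p) (q : ℝ) {δ a : ℝ}
    (hδ : 0 < δ) :
    ContinuousOn (fun D => incompleteBeta (1 - δ ^ 2 / D ^ 2) p q) (Set.Icc δ a) := by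
  have hB : ContinuousOn (fun v => incompleteBeta v p q) (Set.Iio 1) := fun v hv =>
    (hasDerivAt_incompleteBeta hp q hv).continuousAt.continuousWithinAt
  have hpos : ∀ D ∈ Set.Icc δ a, 0 < D := fun D hD => hδ.trans_le hD.1
  refine hB.comp (ContinuousOn.sub continuousOn_const (ContinuousOn.div continuousOn_const
    (by fun_prop) fun D hD => pow_ne_zero 2 (hpos D hD).ne')) fun D hD => ?_
  have := hpos D hD
  have : 0 < δ ^ 2 / D ^ 2 := by positivity
  simp only [Set.mem_Iio]
  linarith

/-- In the derivative of the claimed primitive, the terms from differentiating the two Beta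
functions cancel, as `D^(n+2) * (D/δ) = δ^(n+2) * (D/δ)^(n+3)`. At `D = δ` the Beta argument is `0`
and the primitive vanishes. -/
theorem integral_pow_mul_incompleteBeta_of_pos (n : ℕ) {δ a : ℝ} (hδ : 0 < δ) (ha : δ ≤ a) :
    ∫ D in δ..a, D ^ (n + 1) *
        incompleteBeta (1 - δ ^ 2 / D ^ 2) ((((n + 1 : ℕ) : ℝ) + 1) / 2) (1 / 2)
      = (a ^ (n + 2) * incompleteBeta (1 - δ ^ 2 / a ^ 2) ((((n + 1 : ℕ) : ℝ) + 1) / 2) (1 / 2)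
        - δ ^ (n + 2) * incompleteBeta (1 - δ ^ 2 / a ^ 2) ((((n + 1 : ℕ) : ℝ) + 1) / 2)
          (-((n + 1 : ℕ) : ℝ) / 2)) / (n + 2) := by
  have hp := one_le_succ_succ_half n
  have key := intervalIntegral.integral_eq_sub_of_hasDerivAt_of_le ha
    (f := fun D =>
      (D ^ (n + 2) * incompleteBeta (1 - δ ^ 2 / D ^ 2) ((((n + 1 : ℕ) : ℝ) + 1) / 2) (1 / 2)
        - δ ^ (n + 2) * incompleteBeta (1 - δ ^ 2 / D ^ 2) ((((n + 1 : ℕ) : ℝ) + 1) / 2)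
          (-((n + 1 : ℕ) : ℝ) / 2)) / (n + 2))
    (f' := fun D => D ^ (n + 1) *
        incompleteBeta (1 - δ ^ 2 / D ^ 2) ((((n + 1 : ℕ) : ℝ) + 1) / 2) (1 / 2)) ?_ ?_ ?_
  · rw [key]
    simp [incompleteBeta_zero, hδ.ne']
  · exact (((continuous_pow _).continuousOn.mul
      (continuousOn_incompleteBeta_one_sub_sq_div_sq hp _ hδ)).sub (continuousOn_const.mul
      (continuousOn_incompleteBeta_one_sub_sq_div_sq hp _ hδ))).div_const _
  · intro D hD
    have hδD : δ < D := hD.1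
    have hD0 : 0 < D := hδ.trans hδD
    have hu1 : 1 - δ ^ 2 / D ^ 2 < 1 := by
      have : 0 < δ ^ 2 / D ^ 2 := by positivity
      linarith
    have hd : HasDerivAt (fun D : ℝ => 1 - δ ^ 2 / D ^ 2) (2 * δ ^ 2 / D ^ 3) D := by
      have := (((hasDerivAt_pow 2 D).fun_inv (pow_ne_zero 2 hD0.ne')).const_mul (δ ^ 2)).const_sub 1
      simp only [← div_eq_mul_inv] at this
      refine this.congr_deriv ?_
      push_cast
      field_simp
    have h1 := (hasDerivAt_incompleteBeta hp (1 / 2) hu1).comp D hd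
    have h2 := (hasDerivAt_incompleteBeta hp (-((n + 1 : ℕ) : ℝ) / 2) hu1).comp D hd
    have h3 := (((hasDerivAt_pow (n + 2) D).mul h1).sub (h2.const_mul (δ ^ (n + 2)))).div_const
      ((n : ℝ) + 2)
    refine h3.congr_deriv ?_
    have e0 : (1 - (1 - δ ^ 2 / D ^ 2)) = (δ / D) ^ 2 := by rw [div_pow]; ring
    have e1 : ((δ / D) ^ 2) ^ ((1 : ℝ) / 2 - 1) = D / δ := by
      rw [show ((1 : ℝ) / 2 - 1) = -((1 : ℕ) : ℝ) / 2 by norm_num,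
        sq_rpow_neg_half (by positivity), pow_one, inv_div]
    have e2 : ((δ / D) ^ 2) ^ (-((n + 1 : ℕ) : ℝ) / 2 - 1) = (D / δ) ^ (n + 3) := by
      rw [show (-((n + 1 : ℕ) : ℝ) / 2 - 1) = -((n + 3 : ℕ) : ℝ) / 2 by push_cast; ring,
        sq_rpow_neg_half (by positivity), inv_div]
    have hn : (n : ℝ) + 2 ≠ 0 := by positivity
    rw [e0, e1, e2, div_pow]
    simp only [Function.comp_apply]
    generalize incompleteBeta (1 - δ ^ 2 / D ^ 2) ((((n + 1 : ℕ) : ℝ) + 1) / 2) (1 / 2) = b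
    generalize (1 - δ ^ 2 / D ^ 2) ^ ((((n + 1 : ℕ) : ℝ) + 1) / 2 - 1) = c
    push_cast
    field_simp
    ring
  · refine ContinuousOn.intervalIntegrable ?_
    rw [Set.uIcc_of_le ha]
    exact (continuous_pow _).continuousOn.mul
      (continuousOn_incompleteBeta_one_sub_sq_div_sq hp _ hδ)

theorem integral_pow_mul_incompleteBeta (n : ℕ) {δ a : ℝ} (hδ : 0 ≤ δ) (ha : δ ≤ a) :
    ∫ D in δ..a, D ^ (n + 1) *
        incompleteBeta (1 - δ ^ 2 / D ^ 2) ((((n + 1 : ℕ) : ℝ) + 1) / 2) (1 / 2)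
      = (a ^ (n + 2) * incompleteBeta (1 - δ ^ 2 / a ^ 2) ((((n + 1 : ℕ) : ℝ) + 1) / 2) (1 / 2)
        - if δ = 0 then 0 else
          δ ^ (n + 2) * incompleteBeta (1 - δ ^ 2 / a ^ 2) ((((n + 1 : ℕ) : ℝ) + 1) / 2)
            (-((n + 1 : ℕ) : ℝ) / 2)) / (n + 2) := by
  rcases hδ.eq_or_lt with rfl | hδ
  -- For `δ = 0` the Beta factor is constant and only a power of `D` is integrated.
  · simp only [ne_eq, OfNat.ofNat_ne_zero, not_false_eq_true, zero_pow, zero_div, sub_zero,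
      intervalIntegral.integral_mul_const, integral_pow, if_true]
    push_cast
    simp
    ring
  · rw [if_neg hδ.ne', integral_pow_mul_incompleteBeta_of_pos n hδ ha]

/-! ### Volume of the intersection of two balls. -/

theorem measureReal_sum_sq_le (n : ℕ) {ρ : ℝ} (hρ : 0 ≤ ρ) :
    (volume : Measure (Fin n → ℝ)).real {w | ∑ i, w i ^ 2 ≤ ρ ^ 2}
      = √Real.pi ^ n / Real.Gamma ((n : ℝ) / 2 + 1) * ρ ^ n := by
  rcases n with _ | n
  -- The slices of a one-dimensional lens are zero-dimensional: a single point of mass `1`.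
  · have : {w : Fin 0 → ℝ | ∑ i, w i ^ 2 ≤ ρ ^ 2} = Set.univ := by
      ext w
      simp only [Finset.univ_eq_empty, Finset.sum_empty, Set.mem_ofPred_eq, Set.mem_univ, iff_true]
      positivity
    rw [this]
    simp [measureReal_def, volume_pi]
  · have hΓ : 0 < Real.Gamma (((n + 1 : ℕ) : ℝ) / 2 + 1) := Real.Gamma_pos_of_pos (by positivity)
    have hs : {w : Fin (n + 1) → ℝ | ∑ i, w i ^ 2 ≤ ρ ^ 2}
        = WithLp.toLp 2 ⁻¹' Metric.closedBall (0 : EuclideanSpace ℝ (Fin (n + 1))) ρ := by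
      ext w
      rw [Set.mem_preimage, mem_closedBall_zero_iff, ← abs_of_nonneg hρ, ← abs_norm,
        ← sq_le_sq, EuclideanSpace.norm_sq_eq, sq_abs]
      simp
    rw [measureReal_def, hs, (PiLp.volume_preserving_toLp (Fin (n + 1))).measure_preimage
      measurableSet_closedBall.nullMeasurableSet, EuclideanSpace.volume_closedBall,
      ENNReal.toReal_mul, ENNReal.toReal_pow, ENNReal.toReal_ofReal hρ,
      ENNReal.toReal_ofReal (by positivity), Fintype.card_fin, mul_comm]

theorem measureReal_closedBall {n : ℕ} (x : EuclideanSpace ℝ (Fin (n + 1))) {r : ℝ}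
    (hr : 0 ≤ r) :
    volume.real (Metric.closedBall x r)
      = √Real.pi ^ (n + 1) / Real.Gamma (((n + 1 : ℕ) : ℝ) / 2 + 1) * r ^ (n + 1) := by
  have hΓ : 0 < Real.Gamma (((n + 1 : ℕ) : ℝ) / 2 + 1) := Real.Gamma_pos_of_pos (by positivity)
  rw [measureReal_def, EuclideanSpace.volume_closedBall,
      ENNReal.toReal_mul, ENNReal.toReal_pow, ENNReal.toReal_ofReal hr,
      ENNReal.toReal_ofReal (by positivity), Fintype.card_fin, mul_comm]

theorem EuclideanSpace.measureReal_preimage_cons {n : ℕ} {S : Set (ℝ × (Fin n → ℝ))}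
    (hS : MeasurableSet S) (hfin : volume S ≠ ⊤) :
    volume.real {z : EuclideanSpace ℝ (Fin (n + 1)) | (z 0, fun i : Fin n => z i.succ) ∈ S}
      = ∫ s, (volume : Measure (Fin n → ℝ)).real {w | (s, w) ∈ S} := by
  have h := ((volume_preserving_piFinSuccAbove (fun _ : Fin (n + 1) => ℝ) 0).comp
    (PiLp.volume_preserving_ofLp (Fin (n + 1)))).measure_preimage hS.nullMeasurableSet
  have hset : {z : EuclideanSpace ℝ (Fin (n + 1)) | (z 0, fun i : Fin n => z i.succ) ∈ S}
      = (MeasurableEquiv.piFinSuccAbove (fun _ : Fin (n + 1) => ℝ) 0 ∘ WithLp.ofLp) ⁻¹' S := rfl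
  rw [measureReal_def, hset, h]
  rw [Measure.volume_eq_prod] at hfin ⊢
  rw [Measure.prod_apply hS, ← integral_toReal]
  · rfl
  · exact (measurable_measure_prodMk_left hS).aemeasurable
  · exact Measure.ae_measure_lt_top hS hfin

/-- Two balls of radius `r` whose centres lie at distance `2h`, in coordinates in which the
centres are `h` and `-h` on the first axis. -/
theorem measureReal_inter_closedBall_eq {n : ℕ} (x y : EuclideanSpace ℝ (Fin (n + 1))) {r : ℝ}
    (hr : 0 ≤ r) :
    volume.real (Metric.closedBall x r ∩ Metric.closedBall y r)
      = volume.real {z : EuclideanSpace ℝ (Fin (n + 1)) |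
        (|z 0| + dist x y / 2) ^ 2 + ∑ i : Fin n, z i.succ ^ 2 ≤ r ^ 2} := by
  obtain ⟨T, hT⟩ := exists_linearIsometryEquiv_apply_eq ((1 / 2 : ℝ) • (x - y))
  set h := dist x y / 2 with hh
  have hn : ‖(1 / 2 : ℝ) • (x - y)‖ = h := by
    rw [norm_smul, hh, dist_eq_norm]
    norm_num
    ring
  have h0 : 0 ≤ h := by positivity
  rw [hn] at hT
  let m : EuclideanSpace ℝ (Fin (n + 1)) := (1 / 2 : ℝ) • (x + y)
  have hmp : MeasurePreserving (fun z => T (z - m)) volume volume :=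
    T.measurePreserving.comp (measurePreserving_sub_right volume m)
  have hmeas : MeasurableSet {z : EuclideanSpace ℝ (Fin (n + 1)) |
        (|z 0| + h) ^ 2 + ∑ i : Fin n, z i.succ ^ 2 ≤ r ^ 2} :=
    (isClosed_le (by fun_prop) continuous_const).measurableSet
  rw [measureReal_def, measureReal_def, ← hmp.measure_preimage hmeas.nullMeasurableSet]
  congr 2
  ext z
  have key : ∀ p : EuclideanSpace ℝ (Fin (n + 1)), ∀ c : ℝ,
      ‖p - EuclideanSpace.single 0 c‖ ≤ r ↔ (p 0 - c) ^ 2 + ∑ i : Fin n, p i.succ ^ 2 ≤ r ^ 2 := by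
    intro p c
    rw [← abs_of_nonneg hr, ← abs_norm, ← sq_le_sq, EuclideanSpace.norm_sq_eq, sq_abs,
      Fin.sum_univ_succ]
    simp [Fin.succ_ne_zero]
  have ex : z - x = (z - m) - (1 / 2 : ℝ) • (x - y) := by simp only [m]; module
  have ey : z - y = (z - m) - (-((1 / 2 : ℝ) • (x - y))) := by simp only [m]; module
  have hTn : T (-((1 / 2 : ℝ) • (x - y))) = EuclideanSpace.single 0 (-h) := by
    rw [map_neg, hT]
    ext i
    by_cases hi : i = 0 <;> simp [hi]
  simp only [Set.mem_inter_iff, Metric.mem_closedBall, dist_eq_norm, Set.mem_preimage,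
    Set.mem_ofPred_eq]
  rw [← T.norm_map (z - x), ← T.norm_map (z - y), ex, ey, map_sub T (z - m), map_sub T (z - m), hT,
    hTn, key, key]
  generalize T (z - m) = p
  -- The constraint from the farther centre implies the other one; the sign of `p 0` decides which
  -- centre is farther.
  rcases le_total 0 (p 0) with hp | hp
  · rw [abs_of_nonneg hp]
    constructor
    · rintro ⟨_, h2⟩
      linarith
    · intro h2
      exact ⟨by nlinarith [mul_nonneg hp h0], by linarith⟩
  · rw [abs_of_nonpos hp]
    constructor
    · rintro ⟨h2, _⟩
      linarith
    · intro h2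
      exact ⟨by linarith, by nlinarith [mul_nonneg (neg_nonneg.2 hp) h0]⟩

theorem measureReal_inter_closedBall_eq_zero {n : ℕ} {x y : EuclideanSpace ℝ (Fin (n + 1))} {r : ℝ}
    (h : 2 * r < dist x y) : volume.real (Metric.closedBall x r ∩ Metric.closedBall y r) = 0 := by
  rw [(Metric.closedBall_disjoint_closedBall (by linarith)).inter_eq, measureReal_empty]

theorem measureReal_inter_closedBall {n : ℕ} (x y : EuclideanSpace ℝ (Fin (n + 1))) {r : ℝ}
    (hr : 0 < r) (hxy : dist x y ≤ 2 * r) :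
    volume.real (Metric.closedBall x r ∩ Metric.closedBall y r)
      = √Real.pi ^ n / Real.Gamma ((n : ℝ) / 2 + 1) * r ^ (n + 1) *
        incompleteBeta (1 - (dist x y / 2) ^ 2 / r ^ 2)
          ((((n + 1 : ℕ) : ℝ) + 1) / 2) (1 / 2) := by
  set h := dist x y / 2 with hh
  have h0 : 0 ≤ h := by positivity
  have hhr : h ≤ r := by rw [hh]; linarith
  set κ := √Real.pi ^ n / Real.Gamma ((n : ℝ) / 2 + 1) with hκ
  let S : Set (ℝ × (Fin n → ℝ)) := {p | (|p.1| + h) ^ 2 + ∑ i : Fin n, p.2 i ^ 2 ≤ r ^ 2}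
  have hS : MeasurableSet S := (isClosed_le (by fun_prop) continuous_const).measurableSet
  -- Finiteness, needed for Fubini in real-valued form, comes from a ball of the sup norm.
  have hSfin : volume S ≠ ⊤ := by
    have hsub : S ⊆ Metric.closedBall 0 r := by
      rintro ⟨s, w⟩ hp
      have hp : (|s| + h) ^ 2 + ∑ i : Fin n, w i ^ 2 ≤ r ^ 2 := hp
      have hsum : 0 ≤ ∑ i : Fin n, w i ^ 2 := Finset.sum_nonneg fun i _ => sq_nonneg _
      rw [mem_closedBall_zero_iff, Prod.norm_def, max_le_iff, pi_norm_le_iff_of_nonneg hr.le]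
      constructor
      · have : |s| + h ≤ r := abs_le_of_sq_le_sq' (by linarith) hr.le |>.2
        rw [Real.norm_eq_abs]
        linarith
      · intro i
        have h1 := Finset.single_le_sum (f := fun i => w i ^ 2) (fun i _ => sq_nonneg (w i))
          (Finset.mem_univ i)
        have h2 := sq_nonneg (|s| + h)
        exact abs_le_of_sq_le_sq (by linarith) hr.le
    exact ((measure_mono hsub).trans_lt measure_closedBall_lt_top).ne
  -- At `s = 0` the indicator of `Ioc` vanishes although the slice need not be null; this single
  -- point is discarded almost everywhere.
  have hslice : ∀ s : ℝ, (volume : Measure (Fin n → ℝ)).real {w | (s, w) ∈ S}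
      = (Set.Ioc 0 (r - h)).indicator (fun t => κ * √(r ^ 2 - (t + h) ^ 2) ^ n) |s| ∨ s = 0 := by
    intro s
    rcases eq_or_ne s 0 with hs | hs
    · exact Or.inr hs
    left
    have hs' : 0 < |s| := abs_pos.2 hs
    by_cases hc : |s| ≤ r - h
    · rw [Set.indicator_of_mem (Set.mem_Ioc.2 ⟨hs', hc⟩), ← measureReal_sum_sq_le n (Real.sqrt_nonneg _)]
      congr 1
      ext w
      have hle : (|s| + h) ^ 2 ≤ r ^ 2 := pow_le_pow_left₀ (by positivity) (by linarith) 2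
      simp only [S, Set.mem_ofPred_eq]
      rw [Real.sq_sqrt (by linarith)]
      constructor <;> intro _ <;> linarith
    · rw [Set.indicator_of_notMem fun hm => hc (Set.mem_Ioc.1 hm).2]
      have : {w | (s, w) ∈ S} = ∅ := by
        ext w
        simp only [S, Set.mem_ofPred_eq, Set.mem_empty_iff_false, iff_false, not_le]
        have hlt : r ^ 2 < (|s| + h) ^ 2 := pow_lt_pow_left₀ (by linarith) hr.le two_ne_zero
        have hsum : 0 ≤ ∑ i : Fin n, w i ^ 2 := Finset.sum_nonneg fun i _ => sq_nonneg _
        linarith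
      rw [this, measureReal_empty]
  have hae : (fun s : ℝ => (volume : Measure (Fin n → ℝ)).real {w | (s, w) ∈ S}) =ᵐ[volume]
      fun s => (Set.Ioc 0 (r - h)).indicator (fun t => κ * √(r ^ 2 - (t + h) ^ 2) ^ n) |s| := by
    have : ∀ᵐ s : ℝ ∂volume, s ≠ 0 := by simp [ae_iff, measure_singleton]
    filter_upwards [this] with s hs
    exact (hslice s).resolve_right hs
  rw [measureReal_inter_closedBall_eq x y hr.le]
  refine (EuclideanSpace.measureReal_preimage_cons hS hSfin).trans ?_
  rw [integral_congr_ae hae, integral_comp_abs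
    (f := (Set.Ioc 0 (r - h)).indicator (fun t => κ * √(r ^ 2 - (t + h) ^ 2) ^ n)),
    setIntegral_indicator measurableSet_Ioc,
    Set.inter_eq_self_of_subset_right Set.Ioc_subset_Ioi_self,
    ← intervalIntegral.integral_of_le (by linarith), intervalIntegral.integral_const_mul,
    intervalIntegral.integral_comp_add_right (fun t => √(r ^ 2 - t ^ 2) ^ n), zero_add,
    sub_add_cancel, integral_sqrt_sq_sub_sq_pow n h0 hhr hr]
  ring

theorem integral_measureReal_inter_closedBall {n : ℕ} (x y : EuclideanSpace ℝ (Fin (n + 1)))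
    {a : ℝ} (ha : dist x y ≤ a) (ha0 : 0 < a) :
    ∫ D in (0 : ℝ)..a, volume.real (Metric.closedBall x (D / 2) ∩ Metric.closedBall y (D / 2))
      = √Real.pi ^ n / Real.Gamma ((n : ℝ) / 2 + 1) / (2 ^ (n + 1) * (n + 2)) *
        (a ^ (n + 2) *
          incompleteBeta (1 - dist x y ^ 2 / a ^ 2) ((((n + 1 : ℕ) : ℝ) + 1) / 2) (1 / 2)
        - if dist x y = 0 then 0 else
          dist x y ^ (n + 2) *
            incompleteBeta (1 - dist x y ^ 2 / a ^ 2) ((((n + 1 : ℕ) : ℝ) + 1) / 2)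
              (-((n + 1 : ℕ) : ℝ) / 2)) := by
  set κ := √Real.pi ^ n / Real.Gamma ((n : ℝ) / 2 + 1) with hκ
  have hind : ∫ D in (0 : ℝ)..a,
        volume.real (Metric.closedBall x (D / 2) ∩ Metric.closedBall y (D / 2))
      = ∫ D in (0 : ℝ)..a, (Set.Ioc (dist x y) a).indicator (fun D => κ / 2 ^ (n + 1) *
        (D ^ (n + 1) *
        incompleteBeta (1 - dist x y ^ 2 / D ^ 2) ((((n + 1 : ℕ) : ℝ) + 1) / 2) (1 / 2))) D := by
    refine intervalIntegral.integral_congr_ae ?_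
    -- For `D < dist x y` the balls are disjoint, for larger `D` the lens formula applies, and the
    -- tangent case is a null set.
    have hne : ∀ᵐ D : ℝ ∂volume, D ≠ dist x y := by simp [ae_iff, measure_singleton]
    filter_upwards [hne] with D hD hmem
    rw [Set.uIoc_of_le ha0.le] at hmem
    have hD0 : 0 < D := hmem.1
    rcases hD.lt_or_gt with hlt | hgt
    · rw [Set.indicator_of_notMem fun hm => hlt.not_gt hm.1]
      exact measureReal_inter_closedBall_eq_zero (by linarith)
    · rw [Set.indicator_of_mem (Set.mem_Ioc.2 ⟨hgt, hmem.2⟩), measureReal_inter_closedBall x y (by positivity)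
        (by linarith), ← div_pow, div_div_div_cancel_right₀ two_ne_zero, div_pow, div_pow]
      ring
  rw [hind, intervalIntegral.integral_of_le ha0.le, setIntegral_indicator measurableSet_Ioc,
    Set.inter_eq_self_of_subset_right (Set.Ioc_subset_Ioc_left dist_nonneg),
    ← intervalIntegral.integral_of_le ha, intervalIntegral.integral_const_mul,
    integral_pow_mul_incompleteBeta n dist_nonneg ha]
  field_simp

/-! ### Random balls. -/

theorem measureReal_randomBall {n : ℕ} {Ω : Type*} [MeasurableSpace Ω] {P : Measure Ω}
    [IsProbabilityMeasure P] {x y : EuclideanSpace ℝ (Fin (n + 1))} {C a : ℝ} (hC : 0 < C)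
    (ha : 0 < a) (hx : ‖x‖ ≤ C)
    {Y : Ω → EuclideanSpace ℝ (Fin (n + 1))} {D : Ω → ℝ} (hY : Measurable Y) (hD : Measurable D)
    (hYu : pdf.IsUniform Y (Metric.closedBall 0 (C + a / 2)) P volume)
    (hDu : pdf.IsUniform D (Set.Icc 0 a) P volume) (hYD : IndepFun Y D P) :
    P.real {ω | x ∈ Metric.closedBall (Y ω) (D ω / 2) ∧ y ∈ Metric.closedBall (Y ω) (D ω / 2)}
      = if dist x y ≤ a then
          1 / omegaTwo (n + 1) C a *
            (a ^ (n + 1) * incompleteBeta (1 - dist x y ^ 2 / a ^ 2)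
                ((((n + 1 : ℕ) : ℝ) + 1) / 2) (1 / 2)
              - 1 / a * (if dist x y = 0 then 0 else
                  dist x y ^ (n + 1 + 1) *
                    incompleteBeta (1 - dist x y ^ 2 / a ^ 2)
                      ((((n + 1 : ℕ) : ℝ) + 1) / 2) (-((n + 1 : ℕ) : ℝ) / 2)))
        else 0 := by
  let A : Set (ℝ × EuclideanSpace ℝ (Fin (n + 1))) :=
    {p | dist x p.2 ≤ p.1 / 2 ∧ dist y p.2 ≤ p.1 / 2}
  have hA : MeasurableSet A :=
    (measurableSet_le (f := fun p : ℝ × EuclideanSpace ℝ (Fin (n + 1)) => dist x p.2)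
      (by fun_prop) (by fun_prop)).inter
    (measurableSet_le (f := fun p : ℝ × EuclideanSpace ℝ (Fin (n + 1)) => dist y p.2)
      (by fun_prop) (by fun_prop))
  have hev : {ω | x ∈ Metric.closedBall (Y ω) (D ω / 2) ∧
      y ∈ Metric.closedBall (Y ω) (D ω / 2)} = {ω | (D ω, Y ω) ∈ A} := rfl
  set V := volume.real (Metric.closedBall (0 : EuclideanSpace ℝ (Fin (n + 1))) (C + a / 2)) with hV
  have hslice : ∀ t ∈ Set.Icc 0 a, (P.map Y).real {z | (t, z) ∈ A} = V⁻¹ *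
      volume.real (Metric.closedBall x (t / 2) ∩ Metric.closedBall y (t / 2)) := by
    intro t ht
    -- A point within `t/2 ≤ a/2` of `x` has norm at most `C + a/2`, so the support of `Y` contains
    -- the whole lens.
    have hset : Metric.closedBall (0 : EuclideanSpace ℝ (Fin (n + 1))) (C + a / 2) ∩
        {z | (t, z) ∈ A} = Metric.closedBall x (t / 2) ∩ Metric.closedBall y (t / 2) := by
      ext z
      simp only [A, Set.mem_inter_iff, Set.mem_ofPred_eq, Metric.mem_closedBall, dist_comm z x,
        dist_comm z y, and_iff_right_iff_imp]
      rintro ⟨h1, _⟩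
      have h2 := dist_triangle_left z 0 x
      rw [dist_zero_right x] at h2
      linarith [ht.2]
    rw [measureReal_def, hYu, cond_apply measurableSet_closedBall, hset, ENNReal.toReal_mul,
      ENNReal.toReal_inv]
    rfl
  have hprob : P.real {ω | (D ω, Y ω) ∈ A} = a⁻¹ * (V⁻¹ * ∫ t in (0 : ℝ)..a,
      volume.real (Metric.closedBall x (t / 2) ∩ Metric.closedBall y (t / 2))) := by
    rw [hYD.symm.measureReal_eq_integral hD hY hA, hDu, integral_cond,
      setIntegral_congr_fun measurableSet_Icc hslice, integral_const_mul,
      integral_Icc_eq_integral_Ioc, ← intervalIntegral.integral_of_le ha.le]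
    simp [measureReal_def, ha.le]
  rw [hev, hprob]
  by_cases hle : dist x y ≤ a
  · have hΓ : 0 < Real.Gamma (((n + 1 : ℕ) : ℝ) / 2 + 1) := Real.Gamma_pos_of_pos (by positivity)
    have hΓ' : 0 < Real.Gamma ((n : ℝ) / 2 + 1) := Real.Gamma_pos_of_pos (by positivity)
    have hΓe : Real.Gamma ((((n + 1 : ℕ) : ℝ) + 1) / 2) = Real.Gamma ((n : ℝ) / 2 + 1) := by
      congr 1
      push_cast
      ring
    have hπ : 0 < √Real.pi := Real.sqrt_pos.2 Real.pi_pos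
    have hCa : C + a / 2 = (2 * C + a) / 2 := by ring
    have hC2 : 0 < 2 * C + a := by positivity
    rw [if_pos hle, integral_measureReal_inter_closedBall x y hle ha, hV,
      measureReal_closedBall _ (by positivity), omegaTwo, hΓe, hCa, div_pow]
    generalize (if dist x y = 0 then (0 : ℝ) else _) = I
    generalize incompleteBeta (1 - dist x y ^ 2 / a ^ 2) ((((n + 1 : ℕ) : ℝ) + 1) / 2) (1 / 2) = b
    have hn : ((n + 1 : ℕ) : ℝ) + 1 = n + 2 := by push_cast; ring
    rw [hn]
    field_simp
    ring
  · rw [if_neg hle]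
    have : ∫ t in (0 : ℝ)..a,
        volume.real (Metric.closedBall x (t / 2) ∩ Metric.closedBall y (t / 2)) = 0 := by
      rw [intervalIntegral.integral_congr (g := fun _ => (0 : ℝ)), intervalIntegral.integral_zero]
      intro t ht
      rw [Set.uIcc_of_le ha.le] at ht
      exact measureReal_inter_closedBall_eq_zero (by linarith [ht.2])
    rw [this, mul_zero, mul_zero]

/-! ### The three formulas together. -/

theorem proposition1 {d : ℕ} (hd : 1 ≤ d) (M : Set (EuclideanSpace ℝ (Fin d)))
    (x y : EuclideanSpace ℝ (Fin d)) (hx : x ∈ M) (hy : y ∈ M)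
    {Ω : Type*} [MeasurableSpace Ω] (P : Measure Ω) [IsProbabilityMeasure P] :
    -- half-spaces: `X` uniform on the unit sphere (normalized surface measure), `R` uniform
    -- on `[-C, C]`, independent
    (∀ C : ℝ, 0 < C → M ⊆ Metric.closedBall 0 C →
      ∀ (X : Ω → Metric.sphere (0 : EuclideanSpace ℝ (Fin d)) 1) (R : Ω → ℝ),
        Measurable X → Measurable R →
        pdf.IsUniform X Set.univ P
          (volume : Measure (EuclideanSpace ℝ (Fin d))).toSphere →
        pdf.IsUniform R (Set.Icc (-C) C) P volume →
        IndepFun X R P →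
        P.real {ω | x ∈ halfSpaceAt (X ω) (R ω) ∩ M ∧ y ∈ halfSpaceAt (X ω) (R ω) ∩ M}
          = 1 / 2 - 1 / omegaOne d C * dist x y) ∧
    -- balls: centre `Y` uniform on the ball of radius `C + a/2`, diameter `D` uniform
    -- on `[0, a]`, independent
    (∀ C a : ℝ, 0 < C → 0 < a → M ⊆ Metric.closedBall 0 C →
      ∀ (Y : Ω → EuclideanSpace ℝ (Fin d)) (D : Ω → ℝ),
        Measurable Y → Measurable D →
        pdf.IsUniform Y (Metric.closedBall 0 (C + a / 2)) P volume →
        pdf.IsUniform D (Set.Icc 0 a) P volume →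
        IndepFun Y D P →
        P.real {ω | x ∈ Metric.closedBall (Y ω) (D ω / 2) ∩ M ∧
            y ∈ Metric.closedBall (Y ω) (D ω / 2) ∩ M}
          = if dist x y ≤ a then
              1 / omegaTwo d C a *
                (a ^ d * incompleteBeta (1 - dist x y ^ 2 / a ^ 2) (((d : ℝ) + 1) / 2) (1 / 2)
                  - 1 / a * (if dist x y = 0 then 0 else
                      dist x y ^ (d + 1) *
                        incompleteBeta (1 - dist x y ^ 2 / a ^ 2)
                          (((d : ℝ) + 1) / 2) (-(d : ℝ) / 2)))
            else 0) ∧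
    -- hyperrectangles: centre `Z` uniform on the box with half side lengths `r k + a k`
    (∀ a r : Fin d → ℝ, (∀ k, 0 < a k) → M ⊆ {z | ∀ k, z k ∈ Set.Icc (-(r k)) (r k)} →
      ∀ Z : Ω → EuclideanSpace ℝ (Fin d),
        Measurable Z →
        pdf.IsUniform Z {z | ∀ k, z k ∈ Set.Icc (-(r k + a k)) (r k + a k)} P volume →
        P.real {ω | x ∈ hyperrectangleAt a (Z ω) ∩ M ∧ y ∈ hyperrectangleAt a (Z ω) ∩ M}
          = ∏ k, 1 / (2 * (r k + a k)) * max (2 * a k - |x k - y k|) 0) := by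
  -- Positive dimension supplies a first coordinate to split off.
  obtain ⟨n, rfl⟩ : ∃ n, d = n + 1 := ⟨d - 1, by omega⟩
  refine ⟨?_, ?_, ?_⟩
  · intro C hC hM X R hX hR hXu hRu hXR
    simp only [Set.mem_inter_iff, hx, hy, and_true]
    exact measureReal_halfSpace hC (mem_closedBall_zero_iff.1 (hM hx))
      (mem_closedBall_zero_iff.1 (hM hy)) hX hR hXu hRu hXR
  · intro C a hC ha hM Y D hY hD hYu hDu hYD
    simp only [Set.mem_inter_iff, hx, hy, and_true]
    exact measureReal_randomBall hC ha (mem_closedBall_zero_iff.1 (hM hx)) hY hD hYu hDu hYD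
  · intro a r ha hM Z _ hZu
    simp only [Set.mem_inter_iff, hx, hy, and_true]
    exact measureReal_hyperrectangle ha (hM hx) hZu
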